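/- Let $X^{(1)},X^{(2)}$ be independent homogeneous Poisson point processes in $\mathbb{R}^3$ with intensities $\lambda_1,\lambda_2>0$. For a locally finite set $\varphi\subset\mathbb{R}^3$, the relative neighborhood graph $\mathrm{Rng}(\varphi)$ has vertex set $\varphi$, and distinct $x,y\in\varphi$ are joined by an edge (the segment $[x,y]$) if and only if there is no $z\in\varphi\setminus\{x,y\}$ with $\max\{|x-z|,|y-z|\}\le|x-y|$; it is identified with the union of its vertices and edges in $\mathbb{R}^3$. With $\mathrm{dist}(x,S)=\inf_{s\in S}|x-s|$ (and $\inf\emptyset=\infty$), let $$\Xi_1=\Big\{x\in\mathbb{R}^3:\ \mathrm{dist}\big(x,\mathrm{Rng}(X^{(1)})\big)\le\min_{j\in\{1,2\}}\mathrm{dist}\big(x,\mathrm{Rng}(X^{(j)})\big)\Big\},\qquad \Xi_1^{\ominus r}=\{x\in\mathbb{R}^3:\ B(x,r)\subseteq\Xi_1\},$$ where $B(x,r)$ is the closed ball of radius $r$ around $x$, and let $W_N=[-N/2,N/2]^2\times[0,1]$. A family of events $\{A_N\}_{N\ge1}$ is said to occur with high probability if there are $c_1,c_2>0$ such that $\mathbb{P}(A_N^c)\le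 c_1e^{-N^{c_2}}$ for all $N\ge1$. **Theorem.** There is $r_0>0$, depending only on $\lambda_1,\lambda_2$, such that for every $r\ge r_0$ and every $\alpha>0$, with high probability every connected component of $\Xi_1^{\ominus r}$ intersecting $W_N$ has (Euclidean) diameter at most $N^\alpha$. -/

import Mathlib

open MeasureTheory ProbabilityTheory Set
open scoped NNReal ENNReal

noncomputable section

namespace RNGModel

/-- Euclidean space `ℝ^d`. -/
abbrev Space (d : ℕ) : Type := EuclideanSpace ℝ (Fin d)

/-- A locally finite subset of `ℝ^d`. -/
structure PointPattern (d : ℕ) where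
  /-- The underlying set of points. -/
  carrier : Set (Space d)
  finite_inter : ∀ B : Set (Space d), Bornology.IsBounded B → (carrier ∩ B).Finite

/-- The number of points of `φ` in `B` (used for bounded `B`, where it is finite). -/
def PointPattern.count {d : ℕ} (φ : PointPattern d) (B : Set (Space d)) : ℕ :=
  (φ.carrier ∩ B).ncard

/-- The usual σ-algebra on point patterns, generated by the numbers of points in bounded Borel
sets. -/
instance {d : ℕ} : MeasurableSpace (PointPattern d) :=
  ⨆ (B : Set (Space d)) (_ : MeasurableSet B) (_ : Bornology.IsBounded B),
    MeasurableSpace.comap (fun φ : PointPattern d => φ.count B) ⊤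

/-- `X` is a homogeneous Poisson point process in `ℝ^d` with intensity `lam`: the number of
points in a bounded Borel set `B` is Poisson distributed with mean `lam * |B|`, and the numbers of
points in pairwise disjoint bounded Borel sets are independent. -/
structure IsPoissonProcess {Ω : Type*} [MeasurableSpace Ω] {d : ℕ}
    (X : Ω → PointPattern d) (lam : ℝ≥0) (μ : Measure Ω) : Prop where
  measurable : Measurable X
  map_count : ∀ B : Set (Space d), MeasurableSet B → Bornology.IsBounded B →
    μ.map (fun ω => (X ω).count B) = poissonMeasure (lam * (volume B).toNNReal)
  indep_count : ∀ (n : ℕ) (B : Fin n → Set (Space d)), (∀ i, MeasurableSet (B i)) →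
    (∀ i, Bornology.IsBounded (B i)) → Pairwise (fun i j => Disjoint (B i) (B j)) →
    iIndepFun (fun i ω => (X ω).count (B i)) μ

/-- The relative neighborhood graph on the vertex set `φ` (points outside `φ` are isolated and
play no role). -/
def relNbhdGraph {d : ℕ} (φ : Set (Space d)) : SimpleGraph (Space d) where
  Adj x y := x ∈ φ ∧ y ∈ φ ∧ x ≠ y ∧
    ¬ ∃ z ∈ φ \ {x, y}, max (dist x z) (dist y z) ≤ dist x y
  symm := ⟨by
    rintro x y ⟨hx, hy, hne, h⟩
    refine ⟨hy, hx, hne.symm, ?_⟩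
    rintro ⟨z, hz, hle⟩
    refine h ⟨z, ?_, ?_⟩
    · rwa [Set.pair_comm]
    · rwa [max_comm, dist_comm x y]⟩
  loopless := ⟨fun _ h => h.2.2.1 rfl⟩

/-- The relative neighborhood graph as a subset of `ℝ^d`: its vertices together with the line
segments that represent its edges. -/
def rngSet {d : ℕ} (φ : Set (Space d)) : Set (Space d) :=
  φ ∪ {p | ∃ x y, (relNbhdGraph φ).Adj x y ∧ p ∈ segment ℝ x y}

/-- The Voronoi mollification of the `i`-th relative neighborhood graph with respect to the
family `Φ`. Distances are extended, so that the distance to the empty set is infinite. -/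
def voronoiMollification {d : ℕ} {ι : Type*} (Φ : ι → Set (Space d)) (i : ι) : Set (Space d) :=
  {x | Metric.infEDist x (rngSet (Φ i)) ≤ ⨅ j, Metric.infEDist x (rngSet (Φ j))}

/-- The erosion of `A` by the closed ball of radius `r` centered at the origin. -/
def erosion {d : ℕ} (A : Set (Space d)) (r : ℝ) : Set (Space d) :=
  {x | Metric.closedBall x r ⊆ A}

/-- The sampling window `[-N/2, N/2]² × [0, 1]` in `ℝ³`. -/
def samplingWindow (N : ℝ) : Set (Space 3) :=
  {x | x 0 ∈ Icc (-N / 2) (N / 2) ∧ x 1 ∈ Icc (-N / 2) (N / 2) ∧ x 2 ∈ Icc (0 : ℝ) 1}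

/-- The family of events `A N`, `N ≥ 1`, occurs with high probability. Here `μ` of a set that is
not known to be measurable is its outer measure. -/
def WithHighProbability {Ω : Type*} [MeasurableSpace Ω] (μ : Measure Ω) (A : ℝ → Set Ω) : Prop :=
  ∃ c₁ > (0 : ℝ), ∃ c₂ > (0 : ℝ), ∀ N : ℝ, 1 ≤ N →
    μ (A N)ᶜ ≤ ENNReal.ofReal (c₁ * Real.exp (-(N ^ c₂)))

end RNGModel

end

namespace RNGModel

theorem PointPattern.count_ne_zero_iff {d : ℕ} (φ : PointPattern d) {B : Set (Space d)}
    (hB : Bornology.IsBounded B) : φ.count B ≠ 0 ↔ ∃ x ∈ φ.carrier, x ∈ B := by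
  rw [PointPattern.count, Ne, Set.ncard_eq_zero (φ.finite_inter B hB), ← Ne, ← nonempty_iff_ne_empty]
  rfl

theorem measurable_count {d : ℕ} {B : Set (Space d)} (hB : MeasurableSet B)
    (hb : Bornology.IsBounded B) : Measurable (fun φ : PointPattern d => φ.count B) := by
  rw [measurable_iff_comap_le]
  exact le_iSup_of_le B (le_iSup_of_le hB (le_iSup_of_le hb le_rfl))

theorem IsPoissonProcess.measure_count_eq_zero {Ω : Type*} [MeasurableSpace Ω] {d : ℕ}
    {X : Ω → PointPattern d} {lam : ℝ≥0} {μ : Measure Ω} (hX : IsPoissonProcess X lam μ)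
    {B : Set (Space d)} (hB : MeasurableSet B) (hb : Bornology.IsBounded B) :
    μ {ω | (X ω).count B = 0} = ENNReal.ofReal (Real.exp (-(lam * (volume B).toReal))) := by
  have h := congrArg (fun ν : Measure ℕ => ν {0}) (hX.map_count B hB hb)
  beta_reduce at h
  have hm : Measurable fun ω => (X ω).count B := (measurable_count hB hb).comp hX.measurable
  rw [Measure.map_apply hm (measurableSet_singleton 0), poissonMeasure_singleton] at h
  simp only [pow_zero, mul_one, Nat.factorial_zero, Nat.cast_one, div_one, NNReal.coe_mul] at h
  exact h

theorem IsPoissonProcess.measure_count_ne_zero_le {Ω : Type*} [MeasurableSpace Ω] {d : ℕ}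
    {X : Ω → PointPattern d} {lam : ℝ≥0} {μ : Measure Ω} [IsProbabilityMeasure μ]
    (hX : IsPoissonProcess X lam μ)
    {B : Set (Space d)} (hB : MeasurableSet B) (hb : Bornology.IsBounded B) :
    μ {ω | (X ω).count B ≠ 0} ≤ lam * volume B := by
  have hm : MeasurableSet {ω | (X ω).count B = 0} :=
    ((measurable_count hB hb).comp hX.measurable) (measurableSet_singleton 0)
  have hc : {ω | (X ω).count B ≠ 0} = {ω | (X ω).count B = 0}ᶜ := rfl
  have hv : (lam : ℝ≥0∞) * volume B = ENNReal.ofReal (lam * (volume B).toReal) := by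
    rw [ENNReal.ofReal_mul lam.coe_nonneg, ENNReal.ofReal_toReal hb.measure_lt_top.ne,
      ENNReal.ofReal_coe_nnreal]
  rw [hc, prob_compl_eq_one_sub hm, hX.measure_count_eq_zero hB hb, hv, ← ENNReal.ofReal_one,
    ← ENNReal.ofReal_sub _ (Real.exp_pos _).le]
  apply ENNReal.ofReal_le_ofReal
  linarith [Real.add_one_le_exp (-(lam * (volume B).toReal))]

/-- The union of all segments between points of `φ` in the closed ball of radius `M`. -/
def segmentUnion {d : ℕ} (φ : PointPattern d) (M : ℝ) : Set (Space d) :=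
  ⋃ a ∈ φ.carrier ∩ Metric.closedBall 0 M, ⋃ b ∈ φ.carrier ∩ Metric.closedBall 0 M, segment ℝ a b

theorem mem_segmentUnion {d : ℕ} {φ : PointPattern d} {M : ℝ} {a b p : Space d}
    (ha : a ∈ φ.carrier) (ha' : ‖a‖ ≤ M) (hb : b ∈ φ.carrier) (hb' : ‖b‖ ≤ M)
    (hp : p ∈ segment ℝ a b) : p ∈ segmentUnion φ M := by
  simp only [segmentUnion, mem_iUnion]
  exact ⟨a, ⟨ha, by simpa using ha'⟩, b, ⟨hb, by simpa using hb'⟩, hp⟩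

theorem isCompact_segmentUnion {d : ℕ} (φ : PointPattern d) (M : ℝ) :
    IsCompact (segmentUnion φ M) := by
  have hf := φ.finite_inter (Metric.closedBall 0 M) Metric.isBounded_closedBall
  refine hf.isCompact_biUnion fun a _ => hf.isCompact_biUnion fun b _ => ?_
  rw [segment_eq_image_lineMap]
  exact isCompact_Icc.image AffineMap.lineMap_continuous

theorem volume_segment {d : ℕ} (hd : 2 ≤ d) (a b : Space d) :
    volume (segment ℝ a b) = 0 := by
  have hs : segment ℝ a b ⊆ line[ℝ, a, b] := by
    rw [segment_eq_image_lineMap]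
    rintro _ ⟨t, -, rfl⟩
    exact AffineMap.lineMap_mem_affineSpan_pair t a b
  refine measure_mono_null hs (Measure.addHaar_affineSubspace _ _ fun h => ?_)
  have h1 : (line[ℝ, a, b]).direction = ⊤ := by rw [h]; exact AffineSubspace.direction_top ..
  rw [direction_affineSpan] at h1
  have h2 := (collinear_pair ℝ a b).finrank_le_one
  rw [h1, finrank_top, finrank_euclideanSpace_fin] at h2
  omega

theorem volume_segmentUnion {d : ℕ} (hd : 2 ≤ d) (φ : PointPattern d) (M : ℝ) :
    volume (segmentUnion φ M) = 0 := by
  have hf := φ.finite_inter (Metric.closedBall 0 M) Metric.isBounded_closedBall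
  rw [segmentUnion, measure_biUnion_null_iff hf.countable]
  intro a _
  rw [measure_biUnion_null_iff hf.countable]
  intro b _
  exact volume_segment hd a b

theorem dist_lineMap_lineMap_le {d : ℕ} {a b a' b' : Space d} {t ε : ℝ} (ht : t ∈ Icc (0 : ℝ) 1)
    (ha : dist a a' ≤ ε) (hb : dist b b' ≤ ε) :
    dist (AffineMap.lineMap a b t) (AffineMap.lineMap a' b' t) ≤ ε := by
  have h : AffineMap.lineMap a b t - AffineMap.lineMap a' b' t =
      (1 - t) • (a - a') + t • (b - b') := by
    simp only [AffineMap.lineMap_apply_module]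
    module
  rw [dist_eq_norm] at ha hb ⊢
  rw [h]
  refine (norm_add_le _ _).trans ?_
  rw [norm_smul, norm_smul, Real.norm_of_nonneg ht.1, Real.norm_of_nonneg (by linarith [ht.2])]
  nlinarith [ht.1, ht.2]

/-- The pairs of patterns such that, up to an error `ε`, some point of the second one lies on a
segment between two points of the first one that are close to the ball of radius `M`. -/
def approxIncidence (d : ℕ) (M ε : ℝ) : Set (PointPattern d × PointPattern d) :=
  ⋃ i : ℕ × ℕ × ℕ, ⋃ _ : ∃ t ∈ Icc (0 : ℝ) 1,
      ‖TopologicalSpace.denseSeq (Space d) i.1‖ ≤ M ∧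
      ‖TopologicalSpace.denseSeq (Space d) i.2.1‖ ≤ M ∧
      dist (TopologicalSpace.denseSeq (Space d) i.2.2)
        (AffineMap.lineMap (TopologicalSpace.denseSeq (Space d) i.1)
          (TopologicalSpace.denseSeq (Space d) i.2.1) t) ≤ 2 * ε,
    ({φ | φ.count (Metric.ball (TopologicalSpace.denseSeq (Space d) i.1) ε) ≠ 0} ∩
        {φ | φ.count (Metric.ball (TopologicalSpace.denseSeq (Space d) i.2.1) ε) ≠ 0}) ×ˢ
      {φ | φ.count (Metric.ball (TopologicalSpace.denseSeq (Space d) i.2.2) ε) ≠ 0}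

theorem measurableSet_approxIncidence (d : ℕ) (M ε : ℝ) :
    MeasurableSet (approxIncidence d M ε) := by
  have h (x : Space d) : MeasurableSet {φ : PointPattern d | φ.count (Metric.ball x ε) ≠ 0} :=
    (measurable_count measurableSet_ball Metric.isBounded_ball)
      (measurableSet_singleton 0).compl
  exact MeasurableSet.iUnion fun i => MeasurableSet.iUnion fun _ => ((h _).inter (h _)).prod (h _)

theorem mem_approxIncidence {d : ℕ} {φ ψ : PointPattern d} {M ε : ℝ} (hε : 0 < ε) (hε1 : ε ≤ 1)
    {y : Space d} (hy : y ∈ ψ.carrier) (hyZ : y ∈ segmentUnion φ M) :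
    (φ, ψ) ∈ approxIncidence d (M + 1) ε := by
  simp only [segmentUnion, mem_iUnion] at hyZ
  obtain ⟨a, ⟨ha, ha'⟩, b, ⟨hb, hb'⟩, hyab⟩ := hyZ
  rw [segment_eq_image_lineMap] at hyab
  obtain ⟨t, ht, rfl⟩ := hyab
  have hden (x : Space d) := (TopologicalSpace.denseRange_denseSeq (Space d)).exists_dist_lt x hε
  obtain ⟨i, hi⟩ := hden a
  obtain ⟨j, hj⟩ := hden b
  obtain ⟨k, hk⟩ := hden (AffineMap.lineMap a b t)
  have hn {x z : Space d} (hx : x ∈ Metric.closedBall 0 M) (h : dist x z < ε) : ‖z‖ ≤ M + 1 := by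
    rw [← dist_zero_right z]
    rw [Metric.mem_closedBall] at hx
    linarith [dist_triangle_left z 0 x]
  simp only [approxIncidence, mem_iUnion]
  refine ⟨(i, j, k), ⟨t, ht, hn ha' hi, hn hb' hj, ?_⟩, ⟨?_, ?_⟩, ?_⟩
  · have := dist_lineMap_lineMap_le ht hi.le hj.le
    have := dist_triangle_left (TopologicalSpace.denseSeq (Space d) k)
      (AffineMap.lineMap (TopologicalSpace.denseSeq (Space d) i)
          (TopologicalSpace.denseSeq (Space d) j) t) (AffineMap.lineMap a b t)
    linarith
  · exact (φ.count_ne_zero_iff Metric.isBounded_ball).2 ⟨a, ha, hi⟩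
  · exact (φ.count_ne_zero_iff Metric.isBounded_ball).2 ⟨b, hb, hj⟩
  · exact (ψ.count_ne_zero_iff Metric.isBounded_ball).2 ⟨_, hy, hk⟩

theorem count_cthickening_ne_zero {d : ℕ} {φ ψ : PointPattern d} {M ε : ℝ} (hε1 : ε ≤ 1)
    (h : (φ, ψ) ∈ approxIncidence d M ε) :
    ψ.count (Metric.cthickening (4 * ε) (segmentUnion φ (M + 1))) ≠ 0 := by
  simp only [approxIncidence, mem_iUnion] at h
  obtain ⟨⟨i, j, k⟩, ⟨t, ht, hMi, hMj, hk⟩, ⟨hi', hj'⟩, hk'⟩ := h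
  obtain ⟨a, ha, hai⟩ := (φ.count_ne_zero_iff Metric.isBounded_ball).1 hi'
  obtain ⟨b, hb, hbj⟩ := (φ.count_ne_zero_iff Metric.isBounded_ball).1 hj'
  obtain ⟨y, hy, hyk⟩ := (ψ.count_ne_zero_iff Metric.isBounded_ball).1 hk'
  have hn {x z : Space d} (hz : ‖z‖ ≤ M) (h : x ∈ Metric.ball z ε) : ‖x‖ ≤ M + 1 := by
    rw [Metric.mem_ball, dist_eq_norm] at h
    linarith [norm_sub_norm_le x z]
  rw [ψ.count_ne_zero_iff (isCompact_segmentUnion φ _).isBounded.cthickening]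
  refine ⟨y, hy, Metric.mem_cthickening_of_dist_le y (AffineMap.lineMap a b t) _ _
    (mem_segmentUnion ha (hn hMi hai) hb (hn hMj hbj) ?_) ?_⟩
  · rw [segment_eq_image_lineMap]
    exact ⟨t, ht, rfl⟩
  · rw [Metric.mem_ball] at hai hbj hyk
    have h1 := dist_lineMap_lineMap_le ht hai.le hbj.le
    rw [dist_comm] at h1
    have h2 := dist_triangle4 y (TopologicalSpace.denseSeq (Space d) k)
      (AffineMap.lineMap (TopologicalSpace.denseSeq (Space d) i)
          (TopologicalSpace.denseSeq (Space d) j) t) (AffineMap.lineMap a b t)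
    simp only at hk
    linarith

theorem ae_disjoint_segmentUnion {Ω : Type*} [MeasurableSpace Ω] {d : ℕ} (hd : 2 ≤ d)
    {X Y : Ω → PointPattern d} {lam lam' : ℝ≥0} {μ : Measure Ω} [IsProbabilityMeasure μ]
    (hX : IsPoissonProcess X lam μ) (hY : IsPoissonProcess Y lam' μ) (hXY : IndepFun X Y μ)
    (M : ℝ) : ∀ᵐ ω ∂μ, ∀ y ∈ (Y ω).carrier, y ∉ segmentUnion (X ω) M := by
  set ε : ℕ → ℝ := fun n => 1 / ((n : ℝ) + 1) with hεdef
  have hε (n : ℕ) : 0 < ε n := by positivity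
  have hε1 (n : ℕ) : ε n ≤ 1 := by
    rw [hεdef, div_le_one (by positivity)]
    linarith [n.cast_nonneg (α := ℝ)]
  set S : Set (PointPattern d × PointPattern d) := ⋂ n, approxIncidence d (M + 1) (ε n)
  have hS : MeasurableSet S := MeasurableSet.iInter fun n => measurableSet_approxIncidence _ _ _
  have hmap : μ.map (fun ω => (X ω, Y ω)) S = 0 := by
    have : IsProbabilityMeasure (μ.map Y) :=
      Measure.isProbabilityMeasure_map hY.measurable.aemeasurable
    rw [(indepFun_iff_map_prod_eq_prod_map_map hX.measurable.aemeasurable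
      hY.measurable.aemeasurable).1 hXY, Measure.measure_prod_null hS]
    refine Filter.Eventually.of_forall fun φ => ?_
    have hsec (n : ℕ) : μ.map Y (Prod.mk φ ⁻¹' S) ≤
        lam' * volume (Metric.cthickening (4 * ε n) (segmentUnion φ (M + 1 + 1))) := by
      rw [Measure.map_apply hY.measurable (measurable_prodMk_left hS)]
      refine le_trans (measure_mono fun ω hω => ?_) (hY.measure_count_ne_zero_le
        Metric.isClosed_cthickening.measurableSet
        (isCompact_segmentUnion φ _).isBounded.cthickening)
      exact count_cthickening_ne_zero (hε1 n) (mem_iInter.1 hω n)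
    have hlim : Filter.Tendsto (fun n => (lam' : ℝ≥0∞) * volume (Metric.cthickening (4 * ε n)
        (segmentUnion φ (M + 1 + 1)))) Filter.atTop (nhds (lam' * 0)) := by
      refine ENNReal.Tendsto.const_mul ?_ (Or.inr ENNReal.coe_ne_top)
      rw [← volume_segmentUnion hd φ (M + 1 + 1)]
      refine (tendsto_measure_cthickening_of_isCompact (isCompact_segmentUnion φ _)).comp ?_
      simpa [hεdef] using (tendsto_one_div_add_atTop_nhds_zero_nat (𝕜 := ℝ)).const_mul 4
    rw [mul_zero] at hlim
    exact le_antisymm (ge_of_tendsto' hlim hsec) zero_le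
  rw [Measure.map_apply (hX.measurable.prodMk hY.measurable) hS] at hmap
  refine measure_mono_null (fun ω hω => ?_) hmap
  simp only [mem_compl_iff, mem_ofPred_eq, not_forall, not_not] at hω
  obtain ⟨y, hy, hyZ⟩ := hω
  exact mem_iInter.2 fun n => mem_approxIncidence (hε n) (hε1 n) hy hyZ


theorem exists_empty_ball_of_adj {d : ℕ} {φ : Set (Space d)} {a b p : Space d} {s : ℝ}
    (h : (relNbhdGraph φ).Adj a b) (hp : p ∈ segment ℝ a b) (hs : 0 < s) (hab : 2 * s ≤ dist a b) :
    ∃ q, dist q p ≤ s ∧ ∀ z ∈ φ, z ∉ Metric.ball q s := by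
  rw [segment_eq_image_lineMap] at hp
  obtain ⟨t, ht, rfl⟩ := hp
  set l := dist a b
  have hl : 0 < l := by linarith
  obtain ⟨u, hut, hul, hul'⟩ : ∃ u : ℝ, |u - t| * l ≤ s ∧ s ≤ u * l ∧ s ≤ (1 - u) * l := by
    have hm : s / l * l = s := div_mul_cancel₀ s hl.ne'
    have hm2 : s / l ≤ 1 / 2 := by rw [div_le_iff₀ hl]; linarith
    rcases lt_or_ge t (s / l) with h1 | h1
    · refine ⟨s / l, ?_, hm.ge, ?_⟩
      · rw [abs_of_pos (by linarith)]
        nlinarith [ht.1]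
      · nlinarith
    · rcases lt_or_ge (1 - s / l) t with h2 | h2
      · refine ⟨1 - s / l, ?_, ?_, ?_⟩
        · rw [abs_of_neg (by linarith)]
          nlinarith [ht.2]
        · nlinarith
        · linarith
      · refine ⟨t, by simpa using hs.le, ?_, ?_⟩
        · nlinarith
        · nlinarith
  have hu0 : 0 ≤ u := by
    by_contra hu
    nlinarith
  have hu1 : 0 ≤ 1 - u := by
    by_contra hu
    nlinarith
  have hqa : dist (AffineMap.lineMap a b u) a = u * l := by
    rw [dist_lineMap_left, Real.norm_of_nonneg hu0]
  have hqb : dist (AffineMap.lineMap a b u) b = (1 - u) * l := by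
    rw [dist_lineMap_right, Real.norm_of_nonneg hu1]
  refine ⟨AffineMap.lineMap a b u, ?_, fun z hz hzq => ?_⟩
  · rwa [dist_lineMap_lineMap, Real.dist_eq]
  · rw [Metric.mem_ball, dist_comm] at hzq
    refine h.2.2.2 ⟨z, ⟨hz, ?_⟩, max_le ?_ ?_⟩
    · rintro (rfl | rfl) <;> linarith
    · linarith [dist_triangle_left a z (AffineMap.lineMap a b u)]
    · linarith [dist_triangle_left b z (AffineMap.lineMap a b u)]

/-- At scale `k`, the balls of radius `k / 2` around the points of `k • T` all meet the pattern. -/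
def IsFilledAtScale {d : ℕ} (T : Set (Space d)) (φ : PointPattern d) (k : ℝ) : Prop :=
  ∀ c ∈ T, φ.count (Metric.ball (k • c) (k / 2)) ≠ 0

theorem IsFilledAtScale.dist_lt {d : ℕ} {T : Set (Space d)}
    (hT : Metric.closedBall 0 2 ⊆ ⋃ c ∈ T, Metric.ball c (1 / 2)) {φ : PointPattern d} {k : ℝ}
    (hk : 0 < k) (h : IsFilledAtScale T φ k) {a b p : Space d}
    (hab : (relNbhdGraph φ.carrier).Adj a b) (hp : p ∈ segment ℝ a b) (hpk : ‖p‖ ≤ k) :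
    dist a b < 2 * k := by
  by_contra! hlt
  obtain ⟨q, hqp, hq⟩ := exists_empty_ball_of_adj hab hp hk hlt
  have hqn : ‖k⁻¹ • q‖ ≤ 2 := by
    rw [dist_eq_norm] at hqp
    rw [norm_smul, norm_inv, Real.norm_of_nonneg hk.le, inv_mul_le_iff₀ hk]
    linarith [norm_sub_norm_le q p]
  obtain ⟨c, hc, hqc⟩ := mem_iUnion₂.1 (hT (mem_closedBall_zero_iff.2 hqn))
  have hqc' : dist (k • c) q < k / 2 := by
    rw [Metric.mem_ball, dist_comm] at hqc
    have := dist_smul₀ k c (k⁻¹ • q)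
    rw [smul_inv_smul₀ hk.ne', Real.norm_of_nonneg hk.le] at this
    rw [this]
    nlinarith
  obtain ⟨z, hz, hzc⟩ := (φ.count_ne_zero_iff Metric.isBounded_ball).1 (h c hc)
  refine hq z hz ?_
  rw [Metric.mem_ball] at hzc ⊢
  linarith [dist_triangle z (k • c) q]

theorem ae_exists_isFilledAtScale {Ω : Type*} [MeasurableSpace Ω] {d : ℕ} (hd : d ≠ 0)
    {X : Ω → PointPattern d} {lam : ℝ≥0} {μ : Measure Ω} (hlam : 0 < lam)
    (hX : IsPoissonProcess X lam μ) {T : Set (Space d)} (hT : T.Finite) :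
    ∀ᵐ ω ∂μ, ∀ n : ℕ, ∃ k : ℕ, n < k ∧ IsFilledAtScale T (X ω) k := by
  rw [ae_all_iff]
  intro n
  set V := (volume (Metric.ball (0 : Space d) 1)).toReal
  have hV : 0 < V := ENNReal.toReal_pos (Metric.measure_ball_pos _ _ one_pos).ne'
    Metric.isBounded_ball.measure_lt_top.ne
  have hbound (k : ℕ) (hk : n < k) :
      μ {ω | ∃ k : ℕ, n < k ∧ IsFilledAtScale T (X ω) k}ᶜ ≤
        ∑ _c ∈ hT.toFinset, ENNReal.ofReal (Real.exp (-(lam * ((k / 2 : ℝ) ^ d * V)))) := by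
    refine (measure_mono (t := ⋃ c ∈ hT.toFinset,
      {ω | (X ω).count (Metric.ball ((k : ℝ) • c) (k / 2)) = 0}) fun ω hω => ?_).trans
      ((measure_biUnion_finset_le _ _).trans (Finset.sum_le_sum fun c _ => ?_))
    · simp only [mem_compl_iff, mem_ofPred_eq, not_exists, not_and, IsFilledAtScale, not_forall,
        not_not] at hω
      obtain ⟨c, hc, h0⟩ := hω k hk
      exact mem_iUnion₂.2 ⟨c, hT.mem_toFinset.2 hc, h0⟩
    · rw [hX.measure_count_eq_zero measurableSet_ball Metric.isBounded_ball,
        Measure.addHaar_ball_of_pos _ _ (half_pos (Nat.cast_pos.2 (by omega))), ENNReal.toReal_mul,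
        ENNReal.toReal_ofReal (by positivity), finrank_euclideanSpace_fin]
  have hlim : Filter.Tendsto (fun k : ℕ => ∑ _c ∈ hT.toFinset,
      ENNReal.ofReal (Real.exp (-(lam * ((k / 2 : ℝ) ^ d * V))))) Filter.atTop (nhds 0) := by
    suffices h : Filter.Tendsto (fun k : ℕ => ENNReal.ofReal
        (Real.exp (-(lam * ((k / 2 : ℝ) ^ d * V))))) Filter.atTop (nhds 0) by
      simpa using tendsto_finsetSum hT.toFinset fun _ _ => h
    rw [← ENNReal.ofReal_zero]
    refine (ENNReal.continuous_ofReal.tendsto 0).comp (Real.tendsto_exp_neg_atTop_nhds_zero.comp ?_)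
    refine Filter.Tendsto.const_mul_atTop (by exact_mod_cast hlam)
      (Filter.Tendsto.atTop_mul_const hV ((Filter.tendsto_pow_atTop hd).comp
      (Filter.Tendsto.atTop_div_const two_pos tendsto_natCast_atTop_atTop)))
  refine le_antisymm (ge_of_tendsto hlim ?_) zero_le
  filter_upwards [Filter.eventually_gt_atTop n] with k hk using hbound k hk

theorem exists_mem_segmentUnion_of_mem_closure {d : ℕ} {T : Set (Space d)}
    (hT : Metric.closedBall 0 2 ⊆ ⋃ c ∈ T, Metric.ball c (1 / 2)) {φ : PointPattern d}
    (h : ∀ n : ℕ, ∃ k : ℕ, n < k ∧ IsFilledAtScale T φ k) {y : Space d}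
    (hy : y ∈ closure (rngSet φ.carrier)) : ∃ n : ℕ, y ∈ segmentUnion φ n := by
  obtain ⟨m, hm⟩ := exists_nat_ge (‖y‖ + 1)
  obtain ⟨k, hmk, hk⟩ := h m
  have hmk' : (m : ℝ) < k := by exact_mod_cast hmk
  have hk0 : (0 : ℝ) < k := m.cast_nonneg.trans_lt hmk'
  refine ⟨3 * k, ?_⟩
  rw [← (isCompact_segmentUnion φ _).isClosed.closure_eq]
  have hy' : y ∈ closure (Metric.ball y 1 ∩ rngSet φ.carrier) :=
    Metric.isOpen_ball.inter_closure ⟨Metric.mem_ball_self one_pos, hy⟩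
  refine closure_mono ?_ hy'
  rintro p ⟨hpy, hp⟩
  have hpk : ‖p‖ ≤ k := by
    rw [Metric.mem_ball, dist_eq_norm] at hpy
    linarith [norm_sub_norm_le p y]
  push_cast
  rcases hp with hp | ⟨a, b, hab, hp⟩
  · exact mem_segmentUnion hp (by linarith) hp (by linarith) (left_mem_segment ℝ p p)
  · have hlt := hk.dist_lt hT hk0 hab hp hpk
    have ha : dist a p ≤ dist a b := by
      rw [← dist_add_dist_of_mem_segment hp]
      linarith [dist_nonneg (x := p) (y := b)]
    have hb : dist b p ≤ dist a b := by
      rw [← dist_add_dist_of_mem_segment hp, dist_comm b p]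
      linarith [dist_nonneg (x := a) (y := p)]
    rw [dist_eq_norm _ p] at ha hb
    exact mem_segmentUnion hab.1 (by linarith [norm_sub_norm_le a p]) hab.2.1
      (by linarith [norm_sub_norm_le b p]) hp

/-- Almost surely, no point of a Poisson process lies in the closure of the relative neighborhood
graph of an independent Poisson process. -/
theorem ae_disjoint_closure_rngSet {Ω : Type*} [MeasurableSpace Ω] {d : ℕ} (hd : 2 ≤ d)
    {X Y : Ω → PointPattern d} {lam lam' : ℝ≥0} {μ : Measure Ω} [IsProbabilityMeasure μ]
    (hlam : 0 < lam) (hX : IsPoissonProcess X lam μ) (hY : IsPoissonProcess Y lam' μ)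
    (hXY : IndepFun X Y μ) :
    ∀ᵐ ω ∂μ, ∀ y ∈ (Y ω).carrier, y ∉ closure (rngSet (X ω).carrier) := by
  obtain ⟨T, -, hT, hcov⟩ := (isCompact_closedBall (0 : Space d) 2).finite_cover_balls
    (e := 1 / 2) (by norm_num)
  filter_upwards [ae_exists_isFilledAtScale (by omega) hlam hX hT,
    ae_all_iff.2 fun n : ℕ => ae_disjoint_segmentUnion hd hX hY hXY n] with ω h1 h2 y hy hcl
  obtain ⟨n, hn⟩ := exists_mem_segmentUnion_of_mem_closure hcov h1 hcl
  exact h2 n y hy hn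


/-- The index of the half-open cube of side `δ` that contains `x`. -/
noncomputable def cell {d : ℕ} (δ : ℝ) (x : Space d) : Fin d → ℤ := fun i => ⌊x i / δ⌋

theorem mem_cell_preimage_iff {d : ℕ} {δ : ℝ} (hδ : 0 < δ) (z : Fin d → ℤ) (x : Space d) :
    x ∈ cell δ ⁻¹' {z} ↔ ∀ i, x i ∈ Ico (δ * z i) (δ * z i + δ) := by
  simp only [mem_preimage, mem_singleton_iff, funext_iff, cell, Int.floor_eq_iff, mem_Ico,
    le_div_iff₀ hδ, div_lt_iff₀ hδ]
  refine forall_congr' fun i => ?_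
  rw [mul_comm δ, add_mul, one_mul]

theorem cell_preimage_eq {d : ℕ} {δ : ℝ} (hδ : 0 < δ) (z : Fin d → ℤ) :
    cell δ ⁻¹' {z} = WithLp.ofLp ⁻¹' (univ.pi fun i => Ico (δ * z i) (δ * z i + δ)) := by
  ext x
  rw [mem_cell_preimage_iff hδ]
  simp

theorem measurableSet_cell_preimage {d : ℕ} {δ : ℝ} (hδ : 0 < δ) (z : Fin d → ℤ) :
    MeasurableSet (cell δ ⁻¹' {z} : Set (Space d)) := by
  rw [cell_preimage_eq hδ]
  exact (PiLp.volume_preserving_ofLp (Fin d)).measurable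
    (MeasurableSet.univ_pi fun _ => measurableSet_Ico)

theorem volume_cell_preimage {d : ℕ} {δ : ℝ} (hδ : 0 < δ) (z : Fin d → ℤ) :
    volume (cell δ ⁻¹' {z} : Set (Space d)) = ENNReal.ofReal δ ^ d := by
  rw [cell_preimage_eq hδ, (PiLp.volume_preserving_ofLp (Fin d)).measure_preimage
    (MeasurableSet.univ_pi fun _ => measurableSet_Ico).nullMeasurableSet, Real.volume_pi_Ico]
  simp

theorem isBounded_cell_preimage {d : ℕ} {δ : ℝ} (hδ : 0 < δ) (z : Fin d → ℤ) :
    Bornology.IsBounded (cell δ ⁻¹' {z} : Set (Space d)) := by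
  rw [cell_preimage_eq hδ]
  exact (PiLp.antilipschitzWith_ofLp 2 _).isBounded_preimage
    (Bornology.IsBounded.pi fun _ => Metric.isBounded_Ico _ _)

theorem IsPoissonProcess.measure_forall_cell_empty {Ω : Type*} [MeasurableSpace Ω] {d : ℕ}
    {X : Ω → PointPattern d} {lam : ℝ≥0} {μ : Measure Ω} (hX : IsPoissonProcess X lam μ) {δ : ℝ}
    (hδ : 0 < δ) {m : ℕ} {g : Fin m → Fin d → ℤ} (hg : Function.Injective g) :
    μ {ω | ∀ k, (X ω).count (cell δ ⁻¹' {g k}) = 0} =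
      ENNReal.ofReal (Real.exp (-(lam * δ ^ d))) ^ m := by
  have hind := hX.indep_count m (fun k => cell δ ⁻¹' {g k})
    (fun k => measurableSet_cell_preimage hδ _) (fun k => isBounded_cell_preimage hδ _)
    fun i j hij => (disjoint_singleton.2 (hg.ne hij)).preimage _
  have hset : {ω | ∀ k, (X ω).count (cell δ ⁻¹' {g k}) = 0} =
      ⋂ k, {ω | (X ω).count (cell δ ⁻¹' {g k}) = 0} := by
    ext ω
    simp
  rw [hset, hind.meas_iInter (s := fun k => {ω | (X ω).count (cell δ ⁻¹' {g k}) = 0})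
    fun k => ⟨{0}, measurableSet_singleton _, rfl⟩]
  simp_rw [hX.measure_count_eq_zero (measurableSet_cell_preimage hδ _)
    (isBounded_cell_preimage hδ _), volume_cell_preimage hδ]
  rw [Finset.prod_const, Finset.card_univ, Fintype.card_fin, ENNReal.toReal_pow,
    ENNReal.toReal_ofReal hδ.le]

/-- A self-avoiding lattice path with `n` steps of sup-norm at most one that starts at `u`. -/
structure IsLatticePath {d n : ℕ} (u : Fin d → ℤ) (g : Fin (n + 1) → Fin d → ℤ) : Prop where
  start : g 0 = u
  injective : Function.Injective g
  step : ∀ (k : Fin n) (i : Fin d), |g k.succ i - g k.castSucc i| ≤ 1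

theorem IsPoissonProcess.measure_exists_vacant_path_le {Ω : Type*} [MeasurableSpace Ω] {d : ℕ}
    {X : Ω → PointPattern d} {lam : ℝ≥0} {μ : Measure Ω} (hX : IsPoissonProcess X lam μ) {δ : ℝ}
    (hδ : 0 < δ) (n : ℕ) (u : Fin d → ℤ) :
    μ {ω | ∃ g : Fin (n + 1) → Fin d → ℤ, IsLatticePath u g ∧
        ∀ k, (X ω).count (cell δ ⁻¹' {g k}) = 0} ≤
      ((3 ^ d) ^ n : ℕ) * ENNReal.ofReal (Real.exp (-(lam * δ ^ d))) ^ (n + 1) := by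
  classical
  set steps : Finset (Fin n → Fin d → ℤ) :=
    Fintype.piFinset fun _ => Fintype.piFinset fun _ => Finset.Icc (-1) 1 with hsteps
  have hcard : steps.card = (3 ^ d) ^ n := by
    simp [hsteps, Fintype.card_piFinset]
  let walk (s : Fin n → Fin d → ℤ) (k : Fin (n + 1)) : Fin d → ℤ := u + Fin.partialSum s k
  refine (measure_mono (t := ⋃ s ∈ steps, {ω | Function.Injective (walk s) ∧
    ∀ k, (X ω).count (cell δ ⁻¹' {walk s k}) = 0}) ?_).trans
      ((measure_biUnion_finset_le _ _).trans ?_)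
  · rintro ω ⟨g, hg, hvac⟩
    set s : Fin n → Fin d → ℤ := fun k => -g k.castSucc + g k.succ
    have hw : walk s = g := by
      rw [← Fin.partialSum_left_neg g, hg.start]
      rfl
    refine mem_iUnion₂.2 ⟨s, ?_, ?_, ?_⟩
    · simp only [hsteps, Fintype.mem_piFinset, Finset.mem_Icc]
      intro k i
      have := abs_le.1 (hg.step k i)
      simp only [s, Pi.add_apply, Pi.neg_apply]
      omega
    · rw [hw]
      exact hg.injective
    · rw [hw]
      exact hvac
  · rw [← hcard, ← nsmul_eq_mul]
    refine Finset.sum_le_card_nsmul _ _ _ fun s _ => ?_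
    by_cases hinj : Function.Injective (walk s)
    · exact (measure_mono fun ω hω => hω.2).trans (hX.measure_forall_cell_empty hδ hinj).le
    · simp [hinj]

/-- The graph on the sites in `S` whose edges join sites at sup-norm distance one. -/
def siteGraph {d : ℕ} (S : Set (Fin d → ℤ)) : SimpleGraph (Fin d → ℤ) where
  Adj u v := u ≠ v ∧ u ∈ S ∧ v ∈ S ∧ ∀ i, |u i - v i| ≤ 1
  symm := ⟨fun _ _ h => ⟨h.1.symm, h.2.2.1, h.2.1, fun i => by
    rw [abs_sub_comm]
    exact h.2.2.2 i⟩⟩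
  loopless := ⟨fun _ h => h.1 rfl⟩

theorem abs_cell_sub_le_one {d : ℕ} {δ : ℝ} (hδ : 0 < δ) {x y : Space d} (h : dist y x < δ)
    (i : Fin d) : |cell δ x i - cell δ y i| ≤ 1 := by
  have hi : |x i - y i| < δ := by
    rw [dist_comm, dist_eq_norm] at h
    simpa using (PiLp.norm_apply_le (x - y) i).trans_lt h
  have hi' : |x i / δ - y i / δ| < 1 := by
    rwa [← sub_div, abs_div, abs_of_pos hδ, div_lt_one hδ]
  rw [abs_lt] at hi'
  have h1 := Int.floor_le (x i / δ)
  have h2 := Int.lt_floor_add_one (x i / δ)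
  have h3 := Int.floor_le (y i / δ)
  have h4 := Int.lt_floor_add_one (y i / δ)
  have h5 : ⌊x i / δ⌋ - ⌊y i / δ⌋ < 2 := by
    have : (⌊x i / δ⌋ : ℝ) - ⌊y i / δ⌋ < 2 := by linarith
    exact_mod_cast this
  have h6 : -2 < ⌊x i / δ⌋ - ⌊y i / δ⌋ := by
    have : (-2 : ℝ) < ⌊x i / δ⌋ - ⌊y i / δ⌋ := by linarith
    exact_mod_cast this
  rw [cell, cell, abs_le]
  omega

theorem reachable_of_isPreconnected {d : ℕ} {δ : ℝ} (hδ : 0 < δ) {C : Set (Space d)}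
    (hC : IsPreconnected C) {S : Set (Fin d → ℤ)} (hS : ∀ x ∈ C, cell δ x ∈ S) {x y : Space d}
    (hx : x ∈ C) (hy : y ∈ C) : (siteGraph S).Reachable (cell δ x) (cell δ y) := by
  refine hC.induction₂ (fun x y => (siteGraph S).Reachable (cell δ x) (cell δ y)) (fun x hx => ?_)
    (fun _ _ _ _ _ _ => SimpleGraph.Reachable.trans) (fun _ _ _ _ => SimpleGraph.Reachable.symm)
    hx hy
  filter_upwards [self_mem_nhdsWithin, nhdsWithin_le_nhds (Metric.ball_mem_nhds x hδ)] with y hy hyx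
  by_cases h : cell δ x = cell δ y
  · rw [h]
  · exact SimpleGraph.Adj.reachable ⟨h, hS x hx, hS y hy, abs_cell_sub_le_one hδ hyx⟩

theorem abs_sub_le_length {d : ℕ} {S : Set (Fin d → ℤ)} {u v : Fin d → ℤ}
    (p : (siteGraph S).Walk u v) (i : Fin d) : |u i - v i| ≤ p.length := by
  induction p with
  | nil => simp
  | @cons u v w h p ih =>
    rw [SimpleGraph.Walk.length_cons, Nat.cast_add, Nat.cast_one]
    linarith [abs_sub_le (u i) (v i) (w i), h.2.2.2 i]

theorem exists_isLatticePath {d : ℕ} {S : Set (Fin d → ℤ)} {u v : Fin d → ℤ} (hu : u ∈ S)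
    (h : (siteGraph S).Reachable u v) {n : ℕ} {i : Fin d} (hn : (n : ℤ) ≤ |u i - v i|) :
    ∃ g : Fin (n + 1) → Fin d → ℤ, IsLatticePath u g ∧ ∀ k, g k ∈ S := by
  obtain ⟨p, hp⟩ := h.exists_isPath
  have hlen : n ≤ p.length := by exact_mod_cast hn.trans (abs_sub_le_length p i)
  have hadj (k : ℕ) (hk : k < n) := p.adj_getVert_succ (hk.trans_le hlen)
  refine ⟨fun k => p.getVert k, ⟨by simp, fun a b hab => ?_, fun k j => ?_⟩, fun k => ?_⟩
  · exact Fin.ext (hp.getVert_injOn (by rw [Set.mem_ofPred_eq]; omega)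
      (by rw [Set.mem_ofPred_eq]; omega) hab)
  · rw [abs_sub_comm]
    exact (hadj k k.2).2.2.2 j
  · refine Fin.cases (by simpa using hu) (fun k => ?_) k
    exact (hadj k k.2).2.2.1


theorem dist_le_two_mul {x y : Space 3} {c : ℝ} (hc : 0 ≤ c) (h : ∀ i, |x i - y i| ≤ c) :
    dist x y ≤ 2 * c := by
  rw [EuclideanSpace.dist_eq, Real.sqrt_le_left (by positivity), Fin.sum_univ_three]
  have h2 (i : Fin 3) : dist (x i) (y i) ^ 2 ≤ c ^ 2 := by
    rw [Real.dist_eq]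
    exact pow_le_pow_left₀ (abs_nonneg _) (h i) 2
  nlinarith [h2 0, h2 1, h2 2]

theorem count_cell_eq_zero {Φ : Fin 2 → PointPattern 3} {r : ℝ} (hr : 0 < r)
    (h : ∀ y ∈ (Φ 1).carrier, y ∉ closure (rngSet (Φ 0).carrier)) {x : Space 3}
    (hx : x ∈ erosion (voronoiMollification (fun i => (Φ i).carrier) 0) r) :
    (Φ 1).count (cell (r / 2) ⁻¹' {cell (r / 2) x}) = 0 := by
  by_contra hne
  obtain ⟨y, hy, hyx⟩ :=
    ((Φ 1).count_ne_zero_iff (isBounded_cell_preimage (half_pos hr) _)).1 hne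
  have hxx : x ∈ cell (r / 2) ⁻¹' {cell (r / 2) x} := rfl
  rw [mem_cell_preimage_iff (half_pos hr)] at hyx hxx
  have hd : dist y x ≤ 2 * (r / 2) := dist_le_two_mul (half_pos hr).le fun i => by
    rw [abs_le]
    constructor <;> linarith [(hyx i).1, (hyx i).2, (hxx i).1, (hxx i).2]
  have hmem : Metric.infEDist y (rngSet (Φ 0).carrier) ≤
      ⨅ j, Metric.infEDist y (rngSet (Φ j).carrier) :=
    hx (Metric.mem_closedBall.2 (by linarith : dist y x ≤ r))
  refine h y hy (Metric.mem_closure_iff_infEDist_zero.2 (le_antisymm ?_ zero_le))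
  have hyr : y ∈ rngSet (Φ 1).carrier := Or.inl hy
  exact (hmem.trans (iInf_le _ 1)).trans (Metric.infEDist_zero_of_mem hyr).le

theorem exists_dist_gt_of_lt_ediam {d : ℕ} {C : Set (Space d)} {L : ℝ}
    (h : ENNReal.ofReal L < Metric.ediam C) (x : Space d) : ∃ y ∈ C, L / 2 < dist x y := by
  by_contra! hle
  refine h.not_ge (Metric.ediam_le fun y hy z hz => ?_)
  rw [edist_dist]
  exact ENNReal.ofReal_le_ofReal
    (by linarith [dist_triangle_left y z x, hle y hy, hle z hz])

theorem exists_vacant_path {Φ : Fin 2 → PointPattern 3} {r L : ℝ} (hr : 0 < r) (hL : 0 ≤ L)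
    (h : ∀ y ∈ (Φ 1).carrier, y ∉ closure (rngSet (Φ 0).carrier)) {x : Space 3}
    (hx : x ∈ erosion (voronoiMollification (fun i => (Φ i).carrier) 0) r)
    (hdiam : ENNReal.ofReal L < Metric.ediam (connectedComponentIn
      (erosion (voronoiMollification (fun i => (Φ i).carrier) 0) r) x))
    {n : ℕ} (hn : n ≤ ⌊L / 4 / (r / 2)⌋₊ - 1) :
    ∃ g : Fin (n + 1) → Fin 3 → ℤ, IsLatticePath (cell (r / 2) x) g ∧
        ∀ k, (Φ 1).count (cell (r / 2) ⁻¹' {g k}) = 0 := by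
  set δ := r / 2
  have hδ : 0 < δ := half_pos hr
  obtain ⟨y, hy, hxy⟩ := exists_dist_gt_of_lt_ediam hdiam x
  have hC : ∀ z ∈ connectedComponentIn (erosion (voronoiMollification
      (fun i => (Φ i).carrier) 0) r) x, cell δ z ∈ {u | (Φ 1).count (cell δ ⁻¹' {u}) = 0} :=
    fun z hz => count_cell_eq_zero hr h (connectedComponentIn_subset _ _ hz)
  have hxC := mem_connectedComponentIn hx
  obtain ⟨i, hi⟩ : ∃ i, L / 4 < |x i - y i| := by
    by_contra! hle
    linarith [dist_le_two_mul (by positivity) hle]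
  refine exists_isLatticePath (i := i) (hC x hxC)
    (reachable_of_isPreconnected hδ isPreconnected_connectedComponentIn hC hxC hy) ?_
  have h1 : L / 4 / δ < |x i / δ - y i / δ| := by
    rw [← sub_div, abs_div, abs_of_pos hδ]
    exact div_lt_div_of_pos_right hi hδ
  have h2 : |x i / δ - y i / δ| ≤ |((cell δ x i : ℤ) : ℝ) - cell δ y i| + 1 := by
    have hx1 : (cell δ x i : ℝ) ≤ x i / δ := Int.floor_le _
    have hx2 : x i / δ < cell δ x i + 1 := Int.lt_floor_add_one _
    have hy1 : (cell δ y i : ℝ) ≤ y i / δ := Int.floor_le _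
    have hy2 : y i / δ < cell δ y i + 1 := Int.lt_floor_add_one _
    rw [abs_le]
    constructor <;> linarith [neg_abs_le ((cell δ x i : ℝ) - cell δ y i),
      le_abs_self ((cell δ x i : ℝ) - cell δ y i)]
  have h3 : (⌊L / 4 / δ⌋₊ : ℝ) ≤ L / 4 / δ := Nat.floor_le (by positivity)
  have h4 : (⌊L / 4 / δ⌋₊ : ℤ) ≤ |cell δ x i - cell δ y i| + 1 := by
    have : (⌊L / 4 / δ⌋₊ : ℝ) ≤ ((|cell δ x i - cell δ y i| + 1 : ℤ) : ℝ) := by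
      push_cast
      linarith
    exact_mod_cast this
  have := abs_nonneg (cell δ x i - cell δ y i)
  omega

theorem cell_mem_of_mem_samplingWindow {N δ : ℝ} (hN : 1 ≤ N) (hδ : 1 ≤ δ) {x : Space 3}
    (hx : x ∈ samplingWindow N) :
    cell δ x ∈ Fintype.piFinset fun _ : Fin 3 => Finset.Icc (-⌈N⌉) ⌈N⌉ := by
  have hxi (i : Fin 3) : |x i| ≤ N := by
    rw [abs_le]
    obtain ⟨h0, h1, h2⟩ := hx
    match i with
    | 0 => exact ⟨by linarith [h0.1], by linarith [h0.2]⟩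
    | 1 => exact ⟨by linarith [h1.1], by linarith [h1.2]⟩
    | 2 => exact ⟨by linarith [h2.1], by linarith [h2.2]⟩
  rw [Fintype.mem_piFinset]
  intro i
  have hdiv : |x i / δ| ≤ N := by
    rw [abs_div, abs_of_pos (by linarith : 0 < δ)]
    exact (div_le_self (abs_nonneg _) hδ).trans (hxi i)
  rw [abs_le] at hdiv
  rw [Finset.mem_Icc, cell, Int.le_floor]
  refine ⟨?_, ?_⟩
  · push_cast
    linarith [Int.le_ceil N]
  · exact Int.cast_le (R := ℝ).1 <| (Int.floor_le (x i / δ)).trans (hdiv.2.trans (Int.le_ceil N))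

theorem card_start_le {N : ℝ} (hN : 1 ≤ N) :
    ((Fintype.piFinset fun _ : Fin 3 => Finset.Icc (-⌈N⌉) ⌈N⌉).card : ℝ) ≤ 125 * N ^ 3 := by
  rw [Fintype.card_piFinset, Finset.prod_const, Finset.card_univ, Fintype.card_fin, Int.card_Icc]
  have h0 : 0 ≤ ⌈N⌉ := Int.ceil_nonneg (by linarith)
  have h1 : (((⌈N⌉ + 1 - -⌈N⌉).toNat : ℕ) : ℝ) = 2 * ⌈N⌉ + 1 := by
    have : (((⌈N⌉ + 1 - -⌈N⌉).toNat : ℕ) : ℤ) = 2 * ⌈N⌉ + 1 := by omega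
    exact_mod_cast this
  have h2 : (0 : ℝ) ≤ ⌈N⌉ := by exact_mod_cast h0
  push_cast
  rw [h1]
  calc (2 * (⌈N⌉ : ℝ) + 1) ^ 3 ≤ (5 * N) ^ 3 := by
        gcongr
        linarith [Int.ceil_lt_add_one N]
    _ = 125 * N ^ 3 := by ring

theorem pow_three_mul_exp_le {α δ N : ℝ} (hα : 0 < α) (hδ : 0 < δ) (hN : 1 ≤ N) :
    125 * N ^ 3 * Real.exp (2 - N ^ α / 4 / δ) ≤
      125 * Real.exp (2 + (1 + 6 / α) ^ 2 * δ) * Real.exp (-(N ^ (α / 2))) := by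
  have hN0 : 0 < N := by linarith
  set T := N ^ (α / 2)
  have hT : N ^ α = T ^ 2 := by
    rw [← Real.rpow_natCast, ← Real.rpow_mul hN0.le]
    congr 1
    push_cast
    ring
  have hlog : 3 * Real.log N ≤ 6 / α * T := by
    have h1 : α / 2 * Real.log N ≤ T := by
      rw [← Real.log_rpow hN0]
      exact (Real.log_le_sub_one_of_pos (Real.rpow_pos_of_pos hN0 _)).trans (by linarith)
    calc 3 * Real.log N = 6 / α * (α / 2 * Real.log N) := by field_simp; ring
      _ ≤ 6 / α * T := by gcongr
  have hN3 : N ^ 3 = Real.exp (3 * Real.log N) := by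
    rw [mul_comm, Real.exp_mul, Real.exp_log hN0]
    norm_cast
  have hsq : (1 + 6 / α) * T - T ^ 2 / 4 / δ ≤ (1 + 6 / α) ^ 2 * δ := by
    have : (1 + 6 / α) ^ 2 * δ - ((1 + 6 / α) * T - T ^ 2 / 4 / δ) =
        ((1 + 6 / α) * δ - T / 2) ^ 2 / δ := by
      field_simp
      ring
    have : 0 ≤ ((1 + 6 / α) * δ - T / 2) ^ 2 / δ := by positivity
    linarith
  rw [hN3, hT, mul_assoc, mul_assoc, ← Real.exp_add, ← Real.exp_add]
  refine mul_le_mul_of_nonneg_left (Real.exp_le_exp.2 ?_) (by norm_num)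
  linarith

theorem mul_exp_le_exp_neg_one {lam δ : ℝ} (hδ : 1 ≤ δ) (h : 28 ≤ lam * δ) :
    27 * Real.exp (-(lam * δ ^ 3)) ≤ Real.exp (-1) := by
  have h3 : lam * δ ≤ lam * δ ^ 3 := by
    have : 0 < lam := by
      by_contra! hle
      nlinarith
    gcongr
    exact le_self_pow₀ hδ (by norm_num)
  calc 27 * Real.exp (-(lam * δ ^ 3)) ≤ Real.exp 27 * Real.exp (-28) := by
        gcongr
        · linarith [Real.add_one_le_exp (27 : ℝ)]
        · linarith
    _ = Real.exp (-1) := by rw [← Real.exp_add]; norm_num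

theorem measure_exists_vacant_path_from_window_le {Ω : Type*} [MeasurableSpace Ω]
    {X : Ω → PointPattern 3} {lam : ℝ≥0} {μ : Measure Ω} (hX : IsPoissonProcess X lam μ)
    {δ α N : ℝ} (hδ : 1 ≤ δ) (hlam : 28 ≤ lam * δ) (hα : 0 < α) (hN : 1 ≤ N) {n : ℕ}
    (hn : n = ⌊N ^ α / 4 / δ⌋₊ - 1) :
    μ (⋃ u ∈ Fintype.piFinset fun _ : Fin 3 => Finset.Icc (-⌈N⌉) ⌈N⌉,
        {ω | ∃ g : Fin (n + 1) → Fin 3 → ℤ, IsLatticePath u g ∧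
          ∀ k, (X ω).count (cell δ ⁻¹' {g k}) = 0}) ≤
      ENNReal.ofReal (125 * Real.exp (2 + (1 + 6 / α) ^ 2 * δ) * Real.exp (-(N ^ (α / 2)))) := by
  have hδ0 : 0 < δ := by linarith
  set q := Real.exp (-(lam * δ ^ 3))
  have hq1 : q ≤ 1 := Real.exp_le_one_iff.2 (neg_nonpos.2 (by positivity))
  have hpath : 27 ^ n * q ^ (n + 1) ≤ Real.exp (2 - N ^ α / 4 / δ) := by
    calc 27 ^ n * q ^ (n + 1) = (27 * q) ^ n * q := by ring
      _ ≤ Real.exp (-1) ^ n * 1 := by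
        gcongr
        exact mul_exp_le_exp_neg_one hδ hlam
      _ = Real.exp (-n) := by
        rw [mul_one, ← Real.exp_nat_mul]
        simp
      _ ≤ _ := by
        gcongr
        have h1 := Nat.lt_floor_add_one (N ^ α / 4 / δ)
        have h2 : (⌊N ^ α / 4 / δ⌋₊ : ℝ) ≤ n + 1 := by
          exact_mod_cast (by omega : ⌊N ^ α / 4 / δ⌋₊ ≤ n + 1)
        linarith
  refine (measure_biUnion_finset_le _ _).trans ((Finset.sum_le_card_nsmul _ _ _
    fun u _ => hX.measure_exists_vacant_path_le hδ0 n u).trans ?_)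
  rw [nsmul_eq_mul, ← ENNReal.ofReal_pow (Real.exp_pos _).le, ← ENNReal.ofReal_natCast,
    ← ENNReal.ofReal_natCast, ← ENNReal.ofReal_mul (Nat.cast_nonneg _),
    ← ENNReal.ofReal_mul (Nat.cast_nonneg _)]
  refine ENNReal.ofReal_le_ofReal (le_trans ?_ (pow_three_mul_exp_le hα hδ0 hN))
  push_cast
  exact mul_le_mul (card_start_le hN) hpath (by positivity) (by positivity)

end RNGModel
theorem mainTheorem7 (lam : Fin 2 → ℝ≥0) (hlam : ∀ i, 0 < lam i) :
    ∃ r₀ > (0 : ℝ),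
      ∀ (Ω : Type*) [MeasurableSpace Ω] (μ : Measure Ω) [IsProbabilityMeasure μ]
        (X : Fin 2 → Ω → RNGModel.PointPattern 3),
        (∀ i, RNGModel.IsPoissonProcess (X i) (lam i) μ) → iIndepFun X μ →
        ∀ r : ℝ, r₀ ≤ r → ∀ α : ℝ, 0 < α →
          RNGModel.WithHighProbability μ (fun N : ℝ =>
            {ω | ∀ x ∈ RNGModel.erosion
                    (RNGModel.voronoiMollification (fun i => (X i ω).carrier) 0) r ∩
                  RNGModel.samplingWindow N,
              Metric.ediam (connectedComponentIn
                  (RNGModel.erosion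
                    (RNGModel.voronoiMollification (fun i => (X i ω).carrier) 0) r) x)
                ≤ ENNReal.ofReal (N ^ α)}) := by
  have hlam1 : (0 : ℝ) < lam 1 := by exact_mod_cast hlam 1
  refine ⟨2 + 56 / lam 1, by positivity, fun Ω _ μ _ X hX hind r hr α hα => ?_⟩
  have h56 : 0 < 56 / (lam 1 : ℝ) := by positivity
  have hδ : 1 ≤ r / 2 := by linarith
  have hlamδ : 28 ≤ lam 1 * (r / 2) := by
    have := (div_le_iff₀ hlam1).1 (by linarith : 56 / (lam 1 : ℝ) ≤ r)
    linarith
  have hgood : μ {ω | ¬ ∀ y ∈ (X 1 ω).carrier, y ∉ closure (RNGModel.rngSet (X 0 ω).carrier)} = 0 :=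
    RNGModel.ae_disjoint_closure_rngSet (by norm_num) (hlam 0) (hX 0) (hX 1)
      (hind.indepFun (by decide : (0 : Fin 2) ≠ 1))
  refine ⟨125 * Real.exp (2 + (1 + 6 / α) ^ 2 * (r / 2)), by positivity, α / 2, half_pos hα,
    fun N hN => ?_⟩
  refine le_trans (measure_mono_ae (ae_le_set.2 ?_))
    (RNGModel.measure_exists_vacant_path_from_window_le (hX 1) hδ hlamδ hα hN rfl)
  refine measure_mono_null (fun ω hmem => ?_) hgood
  refine fun hω => hmem.2 ?_
  have hbad := hmem.1
  simp only [mem_compl_iff, mem_ofPred_eq, not_forall, not_le] at hbad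
  obtain ⟨x, ⟨hx, hxN⟩, hdiam⟩ := hbad
  exact mem_iUnion₂.2 ⟨_, RNGModel.cell_mem_of_mem_samplingWindow hN hδ hxN,
    RNGModel.exists_vacant_path (Φ := fun i => X i ω) (by linarith)
      (Real.rpow_nonneg (by linarith) _) hω hx hdiam le_rfl⟩
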